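/- Let $D$ be a connected (non-split) link diagram on the oriented sphere $S^2$ with $c(D)\ge 1$ crossings, and let $s_A$, $s_B$ be the states in which every crossing is given its $A$-splitting, respectively its $B$-splitting (the $A$-quadrants at a crossing are those swept out by the overcrossing strand when it is turned anticlockwise). Write $|s|$ for the number of state circles of a state $s$, and $a(s)$, $b(s)$ for the numbers of crossings that $s$ labels $A$, $B$. The \emph{extreme states bound} for the spread of the Kauffman bracket of $D$ is $\max(s_A)-\min(s_B)=2\,(c(D)+|s_A|+|s_B|-2)$, where $\max(s)=a(s)-b(s)+2|s|-2$ and $\min(s)=a(s)-b(s)-2|s|+2$. Call an edge of the $4$-valent projection graph of $D$ non-alternating if it is over at both ends (sign $+$) or under at both ends (sign $-$). The \emph{non-alternating skeleton} $G$ of $D$ is the embedded graph dual to the non-alternating edges: it has one vertex in each complementary region of the projection whose boundary contains a non-alternating edge, and one edge across each non-alternating edge, carrying its sign. The signs alternate around every vertex of $G$. Let $v(G)$ be the number of vertices of $G$. Let $|G_A|$ be the number of closed curves obtained by splitting every vertex of $G$, joining each $+$ edge to the next $-$ edge in the anticlockwise sense, and let $|G_B|$ be the number obtained with the clockwise sense.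 Let $F$ be the \emph{extreme states (Turaev) surface} of $D$: take a disc around each crossing, join the discs by an untwisted band along each alternating edge and by a half-twisted band along each non-alternating edge, and cap off every boundary component by a disc. Then: 1. $\chi(F)=2-v(G)+|G_A|+|G_B|$. 2. $F$ is a connected closed orientable surface, and in terms of its genus $g(F)$ the extreme states bound for the spread equals $$4c(D)-4g(F)=4c(D)+2\,(|G_A|+|G_B|)-2v(G).$$ 3. Consequently, apart from the term $4c(D)$, the extreme states bound depends only on the embedded signed graph $G$: if $D'$ is another such diagram, and its skeleton is isomorphic to that of $D$ by an isomorphism respecting the signs and the anticlockwise order of the edges around each vertex, then the extreme states bound minus four times the number of crossings is the same for $D$ and $D'$. -/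

import Mathlib

noncomputable section

/-- A rotation system on a set `H` of half-edges: a graph without isolated vertices, cellularly drawn
on oriented surfaces. `rot` sends a half-edge to the next one anticlockwise around its vertex, and
`flip` sends a half-edge to the other half of the same edge. -/
structure RotationSystem (H : Type*) where
  rot : Equiv.Perm H
  flip : Equiv.Perm H
  flip_flip : ∀ h, flip (flip h) = h
  flip_ne : ∀ h, flip h ≠ h

namespace RotationSystem

variable {H : Type*} (R : RotationSystem H)

/-- The vertices are the cycles of `rot`. -/
def Vertex : Type _ := Quot fun h h' : H => h' = R.rot h

/-- The vertex at which a half-edge starts. -/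
def vertex (h : H) : R.Vertex := Quot.mk _ h

/-- The edges are the pairs `{h, flip h}`. -/
def Edge : Type _ := Quot fun h h' : H => h' = R.flip h

/-- The walk along the boundary of a complementary region that is kept on the left: run along `h`
to its other end and leave by the next half-edge clockwise. As seen from inside the region, its
sides are met in anticlockwise order. -/
def facePerm : Equiv.Perm H := R.flip.trans R.rot.symm

/-- The complementary regions (faces); the class of `h` is the region to the left of `h`, when `h`
is directed away from its vertex. -/
def Face : Type _ := Quot fun h h' : H => h' = R.facePerm h

/-- The connected components of the graph. -/
def Component : Type _ := Quot fun h h' : H => h' = R.rot h ∨ h' = R.flip h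

def numVertices : ℕ := Nat.card R.Vertex
def numEdges : ℕ := Nat.card R.Edge
def numFaces : ℕ := Nat.card R.Face
def numComponents : ℕ := Nat.card R.Component

/-- Every component is drawn on a sphere (each component has `V - E + F ≤ 2`, with equality exactly
for a sphere). -/
def IsPlanar : Prop :=
  (R.numVertices : ℤ) - R.numEdges + R.numFaces = 2 * R.numComponents

end RotationSystem

/-! ### Link diagrams -/

/-- The projection graph of a link diagram with crossing set `C`. The four half-edges at
a crossing `c` are `(c, 0), (c, 1), (c, 2), (c, 3)` in anticlockwise order, and `glue` says how
they are joined in pairs by the edges of the projection. -/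
def projectionGraph {C : Type*} (glue : Equiv.Perm (C × ZMod 4))
    (h₁ : ∀ h, glue (glue h) = h) (h₂ : ∀ h, glue h ≠ h) : RotationSystem (C × ZMod 4) where
  rot := (Equiv.refl C).prodCongr (Equiv.addRight 1)
  flip := glue
  flip_flip := h₁
  flip_ne := h₂

/-- An unoriented link diagram on the oriented sphere with crossing set `C`. At every crossing `c`
the half-edges `(c, 0), (c, 2)` form the undercrossing strand and `(c, 1), (c, 3)` form the
overcrossing strand. -/
structure LinkDiagram (C : Type*) where
  glue : Equiv.Perm (C × ZMod 4)
  glue_glue : ∀ h, glue (glue h) = h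
  glue_ne : ∀ h, glue h ≠ h
  planar : (projectionGraph glue glue_glue glue_ne).IsPlanar

/-- The label of a crossing in a state. -/
inductive Marker
  | A
  | B

namespace LinkDiagram

variable {C : Type*} (D : LinkDiagram C)

/-- The projection graph, embedded in the sphere. -/
def projection : RotationSystem (C × ZMod 4) := projectionGraph D.glue D.glue_glue D.glue_ne

/-- The diagram is not split, and has at least one crossing. -/
def IsConnected : Prop := D.projection.numComponents = 1

/-- The number `c(D)` of crossings. -/
def numCrossings (_D : LinkDiagram C) : ℕ := Nat.card C

/-- Whether a half-edge belongs to the overcrossing strand at its crossing. -/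
def isOver (h : C × ZMod 4) : Bool := decide (h.2 = 1 ∨ h.2 = 3)

/-! #### States -/

/-- How a splitting at a crossing joins the four half-edges in pairs. Turning the overcrossing
strand anticlockwise sweeps out the quadrants between `1, 2` and between `3, 0`: these are
the `A`-quadrants. The `A`-splitting merges them, so it joins `0` with `1` and `2` with `3`;
the `B`-splitting joins `1` with `2` and `3` with `0`. -/
def splitPartner : Marker → ZMod 4 → ZMod 4
  | .A, i => if i = 1 ∨ i = 3 then i - 1 else i + 1
  | .B, i => if i = 1 ∨ i = 3 then i + 1 else i - 1

/-- The state circles of a state `s`: travel along edges, and through the crossings along the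
splittings chosen by `s`. -/
def StateCircle (s : C → Marker) : Type _ :=
  Quot fun h h' : C × ZMod 4 => h' = D.glue h ∨ h' = (h.1, splitPartner (s h.1) h.2)

/-- The number `|s|` of state circles. -/
def numCircles (s : C → Marker) : ℕ := Nat.card (D.StateCircle s)

/-- The number of crossings which the state `s` labels by `m`. -/
def numLabel (s : C → Marker) (m : Marker) : ℕ := Nat.card {c : C // s c = m}

/-- The maximum degree of `A ^ (a(s) - b(s)) * (- A ^ 2 - A ^ (-2)) ^ (|s| - 1)`. -/
def maxDeg (s : C → Marker) : ℤ :=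
  (numLabel s .A : ℤ) - numLabel s .B + 2 * D.numCircles s - 2

/-- The minimum degree of `A ^ (a(s) - b(s)) * (- A ^ 2 - A ^ (-2)) ^ (|s| - 1)`. -/
def minDeg (s : C → Marker) : ℤ :=
  (numLabel s .A : ℤ) - numLabel s .B - 2 * D.numCircles s + 2

/-- The extreme state in which every crossing is labelled `A`. -/
def stateA : C → Marker := fun _ => .A

/-- The extreme state in which every crossing is labelled `B`. -/
def stateB : C → Marker := fun _ => .B

/-- The extreme states bound `max(s_A) - min(s_B)` for the spread of the Kauffman bracket. -/
def extremeStatesBound : ℤ := D.maxDeg stateA - D.minDeg stateB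

/-! #### Non-alternating edges -/

/-- The edge containing `h` is non-alternating: it is over at both ends or under at both ends. -/
def NonAlternating (h : C × ZMod 4) : Prop := isOver (D.glue h) = isOver h

end LinkDiagram

/-! ### First return maps -/

section FirstReturn

variable {α : Type*} [Finite α] (f : Equiv.Perm α) (P : α → Prop)

theorem exists_return (x : {x // P x}) : ∃ k : ℕ, P ((f ^ (k + 1)) x) := by
  refine ⟨orderOf f - 1, ?_⟩
  have h : orderOf f - 1 + 1 = orderOf f := Nat.sub_add_cancel (orderOf_pos f)
  rw [h, pow_orderOf_eq_one]
  exact x.2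

open Classical in
/-- The first point satisfying `P` among `f x, f (f x), …`. -/
def firstReturnFun (x : {x // P x}) : {x // P x} :=
  ⟨(f ^ (Nat.find (exists_return f P x) + 1)) x, Nat.find_spec (exists_return f P x)⟩

theorem firstReturnFun_injective : Function.Injective (firstReturnFun f P) := by
  classical
  have key : ∀ (x y : {x // P x}) (i j : ℕ), i < j → (∀ k < j, ¬ P ((f ^ (k + 1)) y)) →
      (f ^ (i + 1)) (x : α) = (f ^ (j + 1)) (y : α) → False := by
    intro x y i j hij hmin h
    obtain ⟨d, rfl⟩ := Nat.exists_eq_add_of_lt hij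
    have h2 : i + d + 1 + 1 = (i + 1) + (d + 1) := by omega
    rw [h2, pow_add f (i + 1) (d + 1), Equiv.Perm.mul_apply] at h
    have h3 := (f ^ (i + 1)).injective h
    exact hmin d (by omega) (h3 ▸ x.2)
  intro x y h
  have h' := congrArg Subtype.val h
  simp only [firstReturnFun] at h'
  rcases lt_trichotomy (Nat.find (exists_return f P x)) (Nat.find (exists_return f P y)) with
    hl | he | hl
  · exact (key x y _ _ hl (fun k hk => Nat.find_min _ hk) h').elim
  · rw [he] at h'
    exact Subtype.ext ((f ^ _).injective h')
  · exact (key y x _ _ hl (fun k hk => Nat.find_min _ hk) h'.symm).elim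

/-- The permutation that a permutation `f` of a finite set induces on the points satisfying `P`:
apply `f` until `P` holds again. -/
def firstReturn : Equiv.Perm {x // P x} :=
  Equiv.ofBijective (firstReturnFun f P)
    (Finite.injective_iff_bijective.mp (firstReturnFun_injective f P))

end FirstReturn

/-! ### Embedded graphs with alternating signs -/

/-- An embedded graph (given by its rotation system) whose edges carry signs that alternate around
every vertex. The value `true` of `sign` stands for `+`, and `false` for `-`. -/
structure SignedSkeleton (H : Type*) extends RotationSystem H where
  sign : H → Bool
  sign_flip : ∀ h, sign (flip h) = sign h
  sign_rot : ∀ h, sign (rot h) = !sign h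

namespace SignedSkeleton

variable {H : Type*} (G : SignedSkeleton H)

/-- The closed curves `G_A`: split every vertex by joining each `+` edge to the next edge
anticlockwise, which is a `-` edge. -/
def CurveA : Type _ :=
  Quot fun h h' : H => h' = G.flip h ∨ (G.sign h = true ∧ h' = G.rot h)

/-- The closed curves `G_B`: split every vertex by joining each `+` edge to the next edge
clockwise, which is a `-` edge. -/
def CurveB : Type _ :=
  Quot fun h h' : H => h' = G.flip h ∨ (G.sign h = true ∧ h' = G.rot.symm h)

/-- The number `|G_A|`. -/
def numCurvesA : ℕ := Nat.card G.CurveA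

/-- The number `|G_B|`. -/
def numCurvesB : ℕ := Nat.card G.CurveB

/-- Two embedded graphs with signs are isomorphic: there is a bijection of half-edges which respects
edges, the anticlockwise orders around the vertices, and the signs. -/
def Isomorphic {H' : Type*} (G' : SignedSkeleton H') : Prop :=
  ∃ e : H ≃ H', (∀ h, e (G.rot h) = G'.rot (e h)) ∧ (∀ h, e (G.flip h) = G'.flip (e h)) ∧
    ∀ h, G'.sign (e h) = G.sign h

end SignedSkeleton

/-! ### Surfaces made of discs and bands -/

/-- A surface with boundary made of discs (the vertices) and bands (the edges), together with the
closed surface obtained by capping off its boundary. Every disc is oriented so that `rot` is the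
anticlockwise order of the bands attached to it; a band is untwisted or half-twisted
relative to these orientations. -/
structure BandSurface (H : Type*) extends RotationSystem H where
  twisted : H → Bool
  twisted_flip : ∀ h, twisted (flip h) = twisted h

namespace BandSurface

variable {H : Type*} (F : BandSurface H)

/-- The sides of the bands, near either end, are `(h, true)`, the left side of `h`
directed away from its disc (the anticlockwise side), and `(h, false)`, its right side. Two of them
are consecutive on the boundary if they are joined by an arc of the boundary of a disc, or are
the two ends of the same side of a band. An untwisted band leads the left side of `h` to the right
side of `flip h`, and a half-twisted one leads it to the left side of `flip h`. -/
def BoundaryStep (p q : H × Bool) : Prop :=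
  (p.2 = true ∧ q = (F.rot p.1, false)) ∨
    q = (F.flip p.1, if F.twisted p.1 then p.2 else !p.2)

/-- The boundary components of the surface with boundary. -/
def BoundaryComponent : Type _ := Quot F.BoundaryStep

/-- The Euler characteristic of the closed surface: discs at the vertices, minus
bands, plus the discs which cap off the boundary components. -/
def eulerChar : ℤ :=
  (F.numVertices : ℤ) - F.numEdges + Nat.card F.BoundaryComponent

def IsConnected : Prop := F.numComponents = 1

/-- The orientations of some of the discs can be reversed so that they agree across all bands. -/
def IsOrientable : Prop :=
  ∃ reversed : F.Vertex → Bool, ∀ h,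
    F.twisted h = xor (reversed (F.vertex h)) (reversed (F.vertex (F.flip h)))

/-- The closed surface is connected and orientable, of genus `g`. -/
def HasGenus (g : ℕ) : Prop :=
  F.IsConnected ∧ F.IsOrientable ∧ F.eulerChar = 2 - 2 * (g : ℤ)

end BandSurface

namespace LinkDiagram

variable {C : Type*} (D : LinkDiagram C)

/-- The extreme states surface (Turaev surface): a disc around each crossing, an untwisted band along
each alternating edge, a half-twisted band along each non-alternating edge, and the boundary is
capped off. -/
def extremeStatesSurface : BandSurface (C × ZMod 4) where
  toRotationSystem := D.projection
  twisted h := isOver (D.glue h) == isOver h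
  twisted_flip h := by
    change (isOver (D.glue (D.glue h)) == isOver (D.glue h)) = _
    rw [D.glue_glue, Bool.beq_comm]

theorem nonAlternating_glue (h : C × ZMod 4) : D.NonAlternating h ↔ D.NonAlternating (D.glue h) := by
  unfold NonAlternating
  rw [D.glue_glue, eq_comm]

theorem over_facePerm (h : C × ZMod 4) :
    isOver (D.projection.facePerm h) = !isOver (D.glue h) := by
  change isOver ((D.glue h).1, (D.glue h).2 + -1) = _
  have key : ∀ i : ZMod 4,
      decide (i + -1 = 1 ∨ i + -1 = 3) = !decide (i = 1 ∨ i = 3) := by decide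
  exact key _

theorem over_facePerm_pow (h : C × ZMod 4) (hh : D.NonAlternating h) (k : ℕ)
    (hk : ∀ j < k, ¬ D.NonAlternating ((D.projection.facePerm ^ (j + 1)) h)) :
    isOver ((D.projection.facePerm ^ (k + 1)) h) = !isOver h := by
  induction k with
  | zero =>
    rw [zero_add, pow_one, over_facePerm, show isOver (D.glue h) = isOver h from hh]
  | succ k ih =>
    have h1 := ih fun j hj => hk j (by omega)
    have h2 := hk k (by omega)
    rw [pow_succ', Equiv.Perm.mul_apply, over_facePerm, ← h1]
    unfold NonAlternating at h2
    revert h2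
    cases isOver (D.glue ((D.projection.facePerm ^ (k + 1)) h)) <;>
      cases isOver ((D.projection.facePerm ^ (k + 1)) h) <;> simp

/-- The non-alternating skeleton: the dual graph to the non-alternating edges in the projection graph.
It has one vertex in each region of the projection whose boundary contains a non-alternating edge,
and one edge across each non-alternating edge. Its half-edges are the non-alternating half-edges `h`
of the projection, where `h` stands for the half lying in the region to the left of `h`. The next
half-edge anticlockwise is given by the next non-alternating edge on the boundary of that region.
Over edges have sign `+`, under edges have sign `-`. -/
def skeleton [Finite C] : SignedSkeleton {h : C × ZMod 4 // D.NonAlternating h} where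
  rot :=
    haveI : Finite (ZMod 4) := inferInstanceAs (Finite (Fin 4))
    firstReturn D.projection.facePerm D.NonAlternating
  flip := D.glue.subtypePerm fun h => (D.nonAlternating_glue h).symm
  flip_flip h := Subtype.ext (D.glue_glue h)
  flip_ne h e := D.glue_ne h (congrArg Subtype.val e)
  sign h := isOver h.1
  sign_flip h := h.2
  sign_rot h := by
    classical
    exact D.over_facePerm_pow h.1 h.2 _ fun j hj => Nat.find_min _ hj

end LinkDiagram

end

/-! Write c for the number of crossings and χ for the Euler characteristic of the surface.
Everything comes from counting its boundary components before capping, in two ways.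

First, an arc of a crossing disc's boundary runs along the `B`-splitting if it leaves an over
half-edge anticlockwise, and along the `A`-splitting otherwise. The half-twists at non-alternating
edges are exactly what keeps a boundary curve of one type throughout. So the components are the
state circles of both extreme states (`boundaryEquivCircles`). With c discs and 2c bands, χ = |s_A|
+ |s_B| - c, and the bound is 4c + 2χ - 4.

Second, the boundary follows the regions of the projection and changes region at non-alternating
edges (`boundaryEquivEnds`). A region without such an edge contributes one component. The rest of
the boundary contracts to curves on the skeleton (`endsEquiv`), each taking only corners from + to -
or only corners from - to +, because the signs alternate; these are the curves of G_A and G_B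
(`curvesEquiv`). Since there are c + 2 regions, the formula for χ follows, and with it the
dependence on the signed skeleton alone.

For the genus, χ ≤ 2 is mod 2 linear algebra (`euler_le_two`). Its equality case on the sphere gives
a chessboard colouring (`exists_chessboard`), from which the disc orientations are read off. That χ
is even is a comparison of signs of permutations (`even_numCircles_add`). -/

noncomputable section

/-! ### Cycles of permutations -/

namespace Equiv.Perm

variable {X : Type*} (π : Perm X)

/-- The cycles of a permutation, fixed points included. -/
abbrev Cycles : Type _ := Quot fun x y : X => y = π x

theorem cycles_mk_eq_iff {x y : X} :
    (Quot.mk _ x : π.Cycles) = Quot.mk _ y ↔ π.SameCycle x y := by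
  constructor
  · intro h
    have h' := Quot.eqvGen_exact h
    induction h' with
    | rel a b hab => subst hab; exact SameCycle.refl π a |>.apply_right
    | refl a => exact SameCycle.refl π a
    | symm a b _ ih => exact (ih (Quot.eqvGen_sound ‹_›)).symm
    | trans a b c _ _ ih₁ ih₂ =>
      exact (ih₁ (Quot.eqvGen_sound ‹_›)).trans (ih₂ (Quot.eqvGen_sound ‹_›))
  · rintro ⟨n, rfl⟩
    have step : ∀ z : X, (Quot.mk _ (π z) : π.Cycles) = Quot.mk _ z :=
      fun z => Eq.symm (by apply Quot.sound; rfl)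
    induction n with
    | zero => rfl
    | succ n ih => rw [add_comm, zpow_add, mul_apply, zpow_one, step, ← ih]
    | pred n ih =>
      rw [← step ((π ^ (-(n : ℤ) - 1)) x), ← mul_apply, ← zpow_one_add, ih]
      congr 3
      ring

variable [Fintype X] [DecidableEq X]

/-- A cycle is a nontrivial cyclic factor or a fixed point. -/
def cyclesToFactors : π.Cycles → π.cycleFactorsFinset ⊕ {x // π x = x} :=
  Quot.lift
    (fun x => if h : π x = x then Sum.inr ⟨x, h⟩
      else Sum.inl ⟨π.cycleOf x, cycleOf_mem_cycleFactorsFinset_iff.2 (mem_support.2 h)⟩)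
    (by
      rintro x _ rfl
      by_cases h : π x = x
      · simp [h]
      · have h' : ¬ π (π x) = π x := fun e => h (π.injective e)
        simp only [h, h', dif_neg, not_false_eq_true, Sum.inl.injEq, Subtype.mk.injEq]
        exact (SameCycle.refl π x).apply_right.cycleOf_eq)

theorem cyclesToFactors_bijective : Function.Bijective π.cyclesToFactors := by
  constructor
  · rintro ⟨x⟩ ⟨y⟩ h
    refine (π.cycles_mk_eq_iff).2 ?_
    simp only [cyclesToFactors] at h
    by_cases hx : π x = x <;> by_cases hy : π y = y <;>
      simp only [hx, hy, dif_pos, dif_neg, not_false_eq_true, reduceCtorEq, Sum.inl.injEq,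
        Sum.inr.injEq, Subtype.mk.injEq] at h
    · rw [h]
    · have h1 : x ∈ (π.cycleOf y).support := by
        rw [← h, mem_support_cycleOf_iff]
        exact ⟨SameCycle.refl π x, mem_support.2 hx⟩
      exact (mem_support_cycleOf_iff.1 h1).1.symm
  · rintro (⟨σ, hσ⟩ | ⟨x, hx⟩)
    · obtain ⟨x, hx⟩ := (mem_cycleFactorsFinset_iff.1 hσ).1.nonempty_support
      have hx' : ¬ π x = x := mem_support.1 (mem_cycleFactorsFinset_support_le hσ hx)
      refine ⟨Quot.mk _ x, ?_⟩
      simp only [cyclesToFactors, hx', dif_neg, not_false_eq_true, Sum.inl.injEq, Subtype.mk.injEq]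
      exact (cycle_is_cycleOf hx hσ).symm
    · exact ⟨Quot.mk _ x, by simp [cyclesToFactors, hx]⟩

/-- The sign of a permutation is the parity of the number of points plus the number of cycles. -/
theorem sign_eq_pow_card_cycles : sign π = (-1) ^ (Nat.card X + Nat.card π.Cycles) := by
  have h1 : Nat.card π.Cycles = π.cycleType.card + Fintype.card {x // π x = x} := by
    rw [Nat.card_congr (Equiv.ofBijective _ π.cyclesToFactors_bijective), Nat.card_sum,
      Nat.card_eq_fintype_card, Nat.card_eq_fintype_card, Fintype.card_coe, cycleType_def,
      Multiset.card_map]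
    rfl
  have h2 : Nat.card X = π.cycleType.sum + Fintype.card {x // π x = x} := by
    rw [Nat.card_eq_fintype_card, sum_cycleType, Fintype.card_subtype,
      ← Finset.card_univ, ← Finset.card_filter_add_card_filter_not (fun x => π x = x), add_comm]
    rfl
  -- Fixed points are counted both as points and as cycles, so they contribute an even exponent; the
  -- rest is the exponent in `sign_of_cycleType`.
  rw [sign_of_cycleType, h1, h2, show ∀ a b c : ℕ, a + b + (c + b) = a + c + 2 * b by
    intros; ring, pow_add _ _ (2 * _), pow_mul]
  simp

end Equiv.Perm

/-- The orbits of two maps which exchange the two classes of a colouring are the cycles of a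
permutation of one class. -/
def quotTwoEquivCycles {X : Type*} (a b : Equiv.Perm X) (ha : ∀ x, a (a x) = x)
    (hb : ∀ x, b (b x) = x) (κ : X → Bool) (ka : ∀ x, κ (a x) = !κ x)
    (kb : ∀ x, κ (b x) = !κ x) (π : Equiv.Perm {x // κ x = true})
    (hπ : ∀ x, (π x : X) = b (a x)) :
    (Quot fun x y : X => y = a x ∨ y = b x) ≃ π.Cycles where
  toFun := Quot.lift
    -- A point of the other colour is pushed by `b` into the chosen class without leaving its orbit.
    -- An `a`-step from `x` then amounts to `x ↦ b (a x)`, which is `π`, and a `b`-step to nothing.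
    (fun x => if h : κ x = true then Quot.mk _ ⟨x, h⟩
      else Quot.mk _ ⟨b x, by rw [kb]; simpa using h⟩)
    (by
      have h1 : ∀ (x : X) (h : κ x = true) (h' : κ (b (a x)) = true),
          (Quot.mk _ ⟨x, h⟩ : π.Cycles) = Quot.mk _ ⟨b (a x), h'⟩ := fun x h h' =>
        Quot.sound (Subtype.ext (hπ ⟨x, h⟩).symm)
      rintro x _ (rfl | rfl)
      · by_cases h : κ x = true
        · have h' : ¬ κ (a x) = true := by rw [ka, h]; simp
          rw [dif_pos h, dif_neg h']
          exact h1 x h _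
        · have h' : κ (a x) = true := by rw [ka]; simpa using h
          rw [dif_neg h, dif_pos h']
          have h2 := h1 (a x) h' (by rw [ha, kb]; simpa using h)
          simp only [ha] at h2
          exact h2.symm
      · by_cases h : κ x = true
        · have h' : ¬ κ (b x) = true := by rw [kb, h]; simp
          simp [h, h', hb]
        · have h' : κ (b x) = true := by rw [kb]; simpa using h
          simp [h, h'])
  invFun := Quot.lift (fun x => Quot.mk _ x.1) (by
    rintro x _ rfl
    rw [hπ]
    refine Eq.trans (b := Quot.mk _ (a x)) ?_ ?_ <;> apply Quot.sound
    · exact Or.inl rfl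
    · exact Or.inr rfl)
  left_inv := by
    rintro ⟨x⟩
    by_cases h : κ x = true
    · simp [h]
    · simp only [h, Bool.false_eq_true, ↓reduceDIte]
      apply Eq.symm
      apply Quot.sound
      exact Or.inr rfl
  right_inv := by
    rintro ⟨⟨x, h⟩⟩
    simp [h]

/-! ### Contracting cycles to the points with a given property -/

section FirstReturn

variable {α : Type*} (f : Equiv.Perm α) (P : α → Prop)

/-- The forward orbit of `x` meets `P`. -/
abbrev Meets (x : α) : Prop := ∃ k : ℕ, P ((f ^ k) x)

/-- By finite order, the forward orbit of `f x` returns to `x`; hence meeting `P` is a property of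
the whole cycle. -/
theorem meets_apply_iff [Finite α] {x : α} : Meets f P (f x) ↔ Meets f P x := by
  constructor
  · rintro ⟨k, hk⟩
    exact ⟨k + 1, by rwa [pow_succ]⟩
  · rintro ⟨k, hk⟩
    obtain ⟨n, hn⟩ : ∃ n, orderOf f = n + 1 := Nat.exists_eq_succ_of_ne_zero (orderOf_pos f).ne'
    refine ⟨k + n, ?_⟩
    rw [← Equiv.Perm.mul_apply, ← pow_succ, add_assoc, ← hn, pow_add, pow_orderOf_eq_one]
    exact hk

theorem meets_of_mem {x : α} (h : P x) : Meets f P x := ⟨0, h⟩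

open Classical in
/-- The first point satisfying `P` among `x, f x, f (f x), …`. -/
def nextPoint (x : α) (h : Meets f P x) : {x // P x} := ⟨(f ^ Nat.find h) x, Nat.find_spec h⟩

theorem nextPoint_of_mem (x : {x // P x}) (h : Meets f P x) : nextPoint f P x h = x := by
  classical
  apply Subtype.ext
  have : Nat.find h = 0 := (Nat.find_eq_zero h).2 x.2
  simp [nextPoint, this]

theorem nextPoint_apply {x : α} (hx : ¬ P x) (h : Meets f P x) (h' : Meets f P (f x)) :
    nextPoint f P (f x) h' = nextPoint f P x h := by
  classical
  apply Subtype.ext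
  have : Nat.find h = Nat.find h' + 1 := by
    rw [Nat.find_eq_iff]
    refine ⟨?_, fun n hn => ?_⟩
    · rw [pow_succ]
      exact Nat.find_spec h'
    · cases n with
      | zero => exact hx
      | succ n =>
        rw [pow_succ]
        exact Nat.find_min h' (by omega)
  simp [nextPoint, this, pow_succ]

/-- The search starts at `f x`, not at `x`, which accounts for the shift by one in `firstReturnFun`.
-/
theorem nextPoint_apply_of_mem [Finite α] (x : {x // P x}) (h : Meets f P (f x)) :
    nextPoint f P (f x) h = firstReturn f P x := by
  classical
  apply Subtype.ext
  have : Nat.find h = Nat.find (exists_return f P x) := by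
    congr 1
  simp [nextPoint, firstReturn, firstReturnFun, this, pow_succ]

/-- Anything which is invariant under `f` outside of `P` has the same value at `x` and at the next
point satisfying `P`. -/
theorem eq_nextPoint [Finite α] {β : Type*} (F : α → β) (hF : ∀ x, ¬ P x → F (f x) = F x) (x : α)
    (h : Meets f P x) : F (nextPoint f P x h) = F x := by
  classical
  obtain ⟨k, hk⟩ := id h
  induction k generalizing x with
  | zero => rw [nextPoint_of_mem f P ⟨x, hk⟩]
  | succ k ih =>
    by_cases hx : P x
    · rw [nextPoint_of_mem f P ⟨x, hx⟩]
    · have h' := (meets_apply_iff f P).2 h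
      rw [← nextPoint_apply f P hx h h', ih (f x) h' (by rwa [← Equiv.Perm.mul_apply, ← pow_succ]),
        hF x hx]

/-- The cycles of `f` without a point satisfying `P`. -/
abbrev MissedCycle : Type _ :=
  Quot fun x y : {x // ¬ Meets f P x} => y.1 = f x.1

open Classical in
/-- The cycles of `f` that meet `P` are the cycles of the first return map. -/
def cyclesEquiv [Finite α] :
    (Quot fun x y : α => y = f x) ≃
      MissedCycle f P ⊕ (Quot fun x y : {x // P x} => y = firstReturn f P x) where
  toFun := Quot.lift
    (fun x => if h : Meets f P x then Sum.inr (Quot.mk _ (nextPoint f P x h))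
      else Sum.inl (Quot.mk _ ⟨x, h⟩))
    (by
      rintro x _ rfl
      by_cases h : Meets f P x
      · have h' := (meets_apply_iff f P).2 h
        rw [dif_pos h, dif_pos h']
        congr 1
        by_cases hx : P x
        · rw [nextPoint_apply_of_mem f P ⟨x, hx⟩ h', nextPoint_of_mem f P ⟨x, hx⟩ h]
          apply Quot.sound
          rfl
        · rw [nextPoint_apply f P hx h h']
      · have h' := (meets_apply_iff f P).not.2 h
        rw [dif_neg h, dif_neg h']
        congr 1
        apply Quot.sound
        rfl)
  invFun := Sum.elim
    (Quot.lift (fun x => Quot.mk _ x.1) (by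
      rintro x y h
      apply Quot.sound
      exact h))
    (Quot.lift (fun x => Quot.mk _ x.1) (by
      rintro x _ rfl
      have h : Meets f P (f x) := (meets_apply_iff f P).2 (meets_of_mem f P x.2)
      have hF : ∀ y : α, (Quot.mk _ (f y) : Quot fun x y : α => y = f x) = Quot.mk _ y :=
        fun y => Eq.symm (by apply Quot.sound; rfl)
      rw [← nextPoint_apply_of_mem f P x h, eq_nextPoint f P (Quot.mk _) (fun y _ => hF y), hF]))
  left_inv := by
    rintro ⟨x⟩
    by_cases h : Meets f P x
    · simp only [h, ↓reduceDIte, Sum.elim_inr]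
      exact eq_nextPoint f P (Quot.mk _) (fun y _ => Eq.symm (by apply Quot.sound; rfl)) x h
    · simp only [h, ↓reduceDIte, Sum.elim_inl]
  right_inv := by
    rintro (⟨⟨x, h⟩⟩ | ⟨⟨x⟩⟩)
    · simp only [Sum.elim_inl, h, ↓reduceDIte]
    · simp only [Sum.elim_inr, meets_of_mem f P x.2, ↓reduceDIte]
      rw [nextPoint_of_mem]

/-- Every point `x` has a beginning `(x, false)` and an end `(x, true)`. The end of `x` is joined to the
beginning of `f x`, the two ends of a point outside of `P` are joined, and those of
the points satisfying `P` are joined according to `S`. -/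
def EndStep (S : {x // P x} × Bool → {x // P x} × Bool → Prop) (p q : α × Bool) : Prop :=
  (p.2 = true ∧ q = (f p.1, false)) ∨ (¬ P p.1 ∧ q = (p.1, !p.2)) ∨
    ∃ (hp : P p.1) (hq : P q.1), S (⟨p.1, hp⟩, p.2) (⟨q.1, hq⟩, q.2)

/-- The end of `x` is joined to the beginning of `g x`, and further points are joined according
to `S`. -/
def ReturnStep {β : Type*} (g : β → β) (S : β × Bool → β × Bool → Prop) (p q : β × Bool) : Prop :=
  (p.2 = true ∧ q = (g p.1, false)) ∨ S p q

variable (S : {x // P x} × Bool → {x // P x} × Bool → Prop)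

open Classical in
/-- The curve pieces obtained by contracting everything outside of `P`. -/
def contractEnds [Finite α] (p : α × Bool) :
    MissedCycle f P ⊕ Quot (ReturnStep (firstReturn f P) S) :=
  if h : Meets f P p.1 then Sum.inr (Quot.mk _
    -- Outside `P` both ends lie on one arc, which continues up to the beginning of the next point
    -- of `P`.
    (if hp : P p.1 then (⟨p.1, hp⟩, p.2) else (nextPoint f P p.1 h, false)))
  else Sum.inl (Quot.mk _ ⟨p.1, h⟩)

theorem contractEnds_of_mem [Finite α] (x : {x // P x}) (b : Bool) :
    contractEnds f P S (x, b) = Sum.inr (Quot.mk _ (x, b)) := by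
  simp [contractEnds, meets_of_mem f P x.2, x.2]

theorem contractEnds_of_missed [Finite α] (x : {x // ¬ Meets f P x}) (b : Bool) :
    contractEnds f P S (x, b) = Sum.inl (Quot.mk _ x) := by
  simp [contractEnds, x.2]

theorem contractEnds_of_meets [Finite α] {x : α} (h : Meets f P x) (hx : ¬ P x) (b : Bool) :
    contractEnds f P S (x, b) = Sum.inr (Quot.mk _ (nextPoint f P x h, false)) := by
  simp [contractEnds, h, hx]

theorem contractEnds_false [Finite α] {x : α} (h : Meets f P x) :
    contractEnds f P S (x, false) = Sum.inr (Quot.mk _ (nextPoint f P x h, false)) := by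
  by_cases hx : P x
  · rw [contractEnds_of_mem f P S ⟨x, hx⟩, nextPoint_of_mem f P ⟨x, hx⟩]
  · exact contractEnds_of_meets f P S h hx _

theorem contractEnds_eq_of_step [Finite α] {p q : α × Bool} (h : EndStep f P S p q) :
    contractEnds f P S p = contractEnds f P S q := by
  obtain ⟨x, b⟩ := p
  rcases h with ⟨hb, rfl⟩ | ⟨hx, rfl⟩ | ⟨hp, hq, h⟩
  · simp only at hb
    subst hb
    by_cases h : Meets f P x
    · have h' := (meets_apply_iff f P).2 h
      rw [contractEnds_false f P S h']
      by_cases hx : P x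
      · rw [contractEnds_of_mem f P S ⟨x, hx⟩, nextPoint_apply_of_mem f P ⟨x, hx⟩]
        exact congrArg _ (Quot.sound (Or.inl ⟨rfl, rfl⟩))
      · rw [contractEnds_of_meets f P S h hx, nextPoint_apply f P hx h]
    · have h' := (meets_apply_iff f P).not.2 h
      rw [contractEnds_of_missed f P S ⟨x, h⟩, contractEnds_of_missed f P S ⟨f x, h'⟩]
      congr 1
      apply Quot.sound
      rfl
  · by_cases h : Meets f P x
    · rw [contractEnds_of_meets f P S h hx, contractEnds_of_meets f P S h hx]
    · rw [contractEnds_of_missed f P S ⟨x, h⟩, contractEnds_of_missed f P S ⟨x, h⟩]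
  · rw [contractEnds_of_mem f P S ⟨x, hp⟩]
    obtain ⟨y, c⟩ := q
    rw [contractEnds_of_mem f P S ⟨y, hq⟩]
    exact congrArg _ (Quot.sound (Or.inr h))

/-- A curve passes straight through a point outside `P`, from its beginning to its end and on to the
next point. This is the invariance that `eq_nextPoint` needs. -/
theorem mk_apply_of_not_mem {x : α} (hx : ¬ P x) :
    (Quot.mk _ (f x, false) : Quot (EndStep f P S)) = Quot.mk _ (x, false) :=
  have h₁ : (Quot.mk _ (x, false) : Quot (EndStep f P S)) = Quot.mk _ (x, true) :=
    Quot.sound (Or.inr (Or.inl ⟨hx, rfl⟩))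
  (h₁.trans (Quot.sound (Or.inl ⟨rfl, rfl⟩))).symm

/-- Contracting everything outside of `P`. -/
def endsEquiv [Finite α] :
    Quot (EndStep f P S) ≃ MissedCycle f P ⊕ Quot (ReturnStep (firstReturn f P) S) where
  toFun := Quot.lift (contractEnds f P S) fun _ _ => contractEnds_eq_of_step f P S
  invFun := Sum.elim
    (Quot.lift (fun x => Quot.mk _ (x.1, false)) (by
      rintro x y h
      rw [h]
      exact (mk_apply_of_not_mem f P S fun hx => x.2 (meets_of_mem f P hx)).symm))
    (Quot.lift (fun p => Quot.mk _ (p.1.1, p.2)) (by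
      rintro ⟨x, b⟩ q (⟨hb, rfl⟩ | h)
      · simp only at hb
        subst hb
        have h : Meets f P (f x) := (meets_apply_iff f P).2 (meets_of_mem f P x.2)
        simp only
        rw [← nextPoint_apply_of_mem f P x h,
          eq_nextPoint f P (fun y => (Quot.mk _ (y, false) : Quot (EndStep f P S)))
            (fun y hy => mk_apply_of_not_mem f P S hy)]
        exact Quot.sound (Or.inl ⟨rfl, rfl⟩)
      · exact Quot.sound (Or.inr (Or.inr ⟨x.2, q.1.2, h⟩))))
  left_inv := by
    rintro ⟨⟨x, b⟩⟩
    change Sum.elim _ _ (contractEnds f P S (x, b)) = _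
    have hb : ¬ P x → (Quot.mk _ (x, false) : Quot (EndStep f P S)) = Quot.mk _ (x, b) := by
      intro hx
      cases b
      · rfl
      · exact Quot.sound (Or.inr (Or.inl ⟨hx, rfl⟩))
    by_cases h : Meets f P x
    · by_cases hx : P x
      · rw [contractEnds_of_mem f P S ⟨x, hx⟩]
        rfl
      · rw [contractEnds_of_meets f P S h hx, ← hb hx]
        exact eq_nextPoint f P (fun y => (Quot.mk _ (y, false) : Quot (EndStep f P S)))
          (fun y hy => mk_apply_of_not_mem f P S hy) x h
    · rw [contractEnds_of_missed f P S ⟨x, h⟩, ← hb fun hx => h (meets_of_mem f P hx)]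
      rfl
  right_inv := by
    rintro (⟨⟨x⟩⟩ | ⟨⟨p⟩⟩)
    · exact contractEnds_of_missed f P S x false
    · exact contractEnds_of_mem f P S p.1 p.2

end FirstReturn

/-! ### Homology of surfaces modulo 2 -/

namespace RotationSystem

variable {H : Type*} (R : RotationSystem H)

instance [Finite H] : Finite R.Vertex := inferInstanceAs (Finite (Quot _))
instance [Finite H] : Finite R.Edge := inferInstanceAs (Finite (Quot _))

/-- The edge containing a half-edge. -/
def edge (h : H) : R.Edge := Quot.mk _ h

theorem edge_flip (h : H) : R.edge (R.flip h) = R.edge h := Eq.symm (Quot.sound rfl)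

theorem vertex_rot (h : H) : R.vertex (R.rot h) = R.vertex h := Eq.symm (Quot.sound rfl)

theorem edge_eq_iff {h h' : H} : R.edge h = R.edge h' ↔ h' = h ∨ h' = R.flip h := by
  constructor
  · intro e
    have e' := Quot.eqvGen_exact e
    clear e
    induction e' with
    | rel a b hab => exact Or.inr hab
    | refl a => exact Or.inl rfl
    | symm a b _ ih =>
      rcases ih with rfl | rfl
      · exact Or.inl rfl
      · exact Or.inr (R.flip_flip _).symm
    | trans a b c _ _ ih₁ ih₂ =>
      rcases ih₁ with rfl | rfl
      · exact ih₂
      · rcases ih₂ with rfl | rfl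
        · exact Or.inr rfl
        · exact Or.inl (R.flip_flip _)
  · rintro (rfl | rfl)
    · rfl
    · exact (R.edge_flip h).symm

/-- Every edge has two halves. -/
theorem edge_halves_bijective :
    Function.Bijective fun p : R.Edge × Bool => if p.2 then R.flip p.1.out else p.1.out := by
  have hout : ∀ e : R.Edge, R.edge e.out = e := Quot.out_eq
  have hedge : ∀ p : R.Edge × Bool,
      R.edge (if p.2 then R.flip p.1.out else p.1.out) = p.1 := by
    rintro ⟨e, _ | _⟩
    · exact hout e
    · exact (R.edge_flip _).trans (hout e)
  constructor
  · intro p q h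
    have h₁ : p.1 = q.1 := by rw [← hedge p, ← hedge q]; exact congrArg _ h
    obtain ⟨e, b⟩ := p
    obtain ⟨_, c⟩ := q
    obtain rfl : e = _ := h₁
    cases b <;> cases c
    · rfl
    · exact (R.flip_ne _ h.symm).elim
    · exact (R.flip_ne _ h).elim
    · rfl
  · intro h
    rcases R.edge_eq_iff.1 (hout (R.edge h)) with h' | h'
    · exact ⟨(R.edge h, false), h'.symm⟩
    · exact ⟨(R.edge h, true), h'.symm⟩

theorem card_halfEdges : Nat.card H = 2 * R.numEdges := by
  rw [← Nat.card_congr (Equiv.ofBijective _ R.edge_halves_bijective), Nat.card_prod, mul_comm,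
    Nat.card_eq_fintype_card (α := Bool), Fintype.card_bool]
  rfl

theorem sum_edges {M : Type*} [AddCommMonoid M] [Fintype H] [Fintype R.Edge] (φ : H → M) :
    ∑ e : R.Edge, (φ e.out + φ (R.flip e.out)) = ∑ h, φ h := by
  rw [← (Equiv.ofBijective _ R.edge_halves_bijective).sum_comp, Fintype.sum_prod_type]
  refine Finset.sum_congr rfl fun e _ => ?_
  rw [Fintype.sum_bool, add_comm]
  rfl

theorem eq_of_invariant (hR : R.numComponents = 1) {β : Type*} (φ : H → β)
    (hrot : ∀ h, φ (R.rot h) = φ h) (hflip : ∀ h, φ (R.flip h) = φ h) (h h' : H) :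
    φ h = φ h' := by
  have hs := (Nat.card_eq_one_iff_unique.1 hR).1
  let ψ : R.Component → β := Quot.lift φ (by
    rintro x _ (rfl | rfl)
    · exact (hrot x).symm
    · exact (hflip x).symm)
  exact congrArg ψ (hs.elim (Quot.mk _ h) (Quot.mk _ h'))

/-- The coboundary of a function on the vertices. -/
def vertexCoboundary : (R.Vertex → ZMod 2) →ₗ[ZMod 2] (R.Edge → ZMod 2) where
  toFun g := Quot.lift (fun h => g (R.vertex h) + g (R.vertex (R.flip h))) (by
    rintro h _ rfl
    rw [R.flip_flip, add_comm])
  map_add' f g := by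
    ext ⟨h⟩
    change f _ + g _ + (f _ + g _) = f _ + f _ + (g _ + g _)
    abel
  map_smul' a f := by
    ext ⟨h⟩
    exact (mul_add a _ _).symm

theorem vertexCoboundary_edge (g : R.Vertex → ZMod 2) (h : H) :
    R.vertexCoboundary g (R.edge h) = g (R.vertex h) + g (R.vertex (R.flip h)) := rfl

/-- Adjunction: the transpose of the vertex coboundary sums an edge function around each vertex. -/
theorem sum_mul_vertexCoboundary [Fintype H] [Fintype R.Edge] (x : R.Edge → ZMod 2)
    (g : R.Vertex → ZMod 2) :
    ∑ e, x e * R.vertexCoboundary g e = ∑ h, x (R.edge h) * g (R.vertex h) := by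
  rw [← R.sum_edges]
  refine Finset.sum_congr rfl fun e _ => ?_
  have he : R.edge e.out = e := Quot.out_eq e
  rw [R.edge_flip, he, ← mul_add, ← R.vertexCoboundary_edge, he]

end RotationSystem

/-- A linear map on a space of functions has rank at least the number of points minus one if its
kernel consists of constant functions. -/
theorem card_le_finrank_range_add_one {K : Type*} [Field K] {X M : Type*} [Finite X] [AddCommGroup M]
    [Module K M] [Module.Finite K M] (d : (X → K) →ₗ[K] M)
    (hd : ∀ f, d f = 0 → ∀ x y, f x = f y) :
    Nat.card X ≤ Module.finrank K (LinearMap.range d) + 1 := by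
  have := Fintype.ofFinite X
  have h1 := d.finrank_range_add_finrank_ker
  rw [Module.finrank_fintype_fun_eq_card, ← Nat.card_eq_fintype_card] at h1
  have h2 : Module.finrank K (LinearMap.ker d) ≤ 1 := by
    rcases isEmpty_or_nonempty X with hX | ⟨⟨x⟩⟩
    · rw [Module.finrank_zero_of_subsingleton]
      exact zero_le_one
    · have := LinearMap.finrank_le_finrank_of_injective
        (f := (LinearMap.proj x : (X → K) →ₗ[K] K).comp (LinearMap.ker d).subtype) (by
          rintro ⟨f, hf⟩ ⟨g, hg⟩ h
          refine Subtype.ext (funext fun y => ?_)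
          change f x = g x at h
          exact (hd f hf y x).trans (h.trans (hd g hg x y)))
      rwa [Module.finrank_self] at this
  omega

/-! ### Mod 2 cocycles of a capped surface and the bound χ ≤ 2 -/

namespace BandSurface

variable {H : Type*} (F : BandSurface H)

instance [Finite H] : Finite F.BoundaryComponent := inferInstanceAs (Finite (Quot _))

/-- The boundary component containing a side of a band. -/
def boundary (p : H × Bool) : F.BoundaryComponent := Quot.mk _ p

theorem boundary_rot (h : H) : F.boundary (F.rot h, false) = F.boundary (h, true) :=
  Eq.symm (Quot.sound (Or.inl ⟨rfl, rfl⟩))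

theorem boundary_flip (h : H) (b : Bool) :
    F.boundary (F.flip h, if F.twisted h then b else !b) = F.boundary (h, b) :=
  Eq.symm (Quot.sound (Or.inr rfl))

/-- A band, twisted or not, at most exchanges its two sides. This makes the mod 2 coboundary well
defined without any orientability. -/
theorem sum_boundary_flip (f : F.BoundaryComponent → ZMod 2) (h : H) :
    f (F.boundary (F.flip h, true)) + f (F.boundary (F.flip h, false)) =
      f (F.boundary (h, true)) + f (F.boundary (h, false)) := by
  rw [← F.boundary_flip h true, ← F.boundary_flip h false]
  cases F.twisted h
  · exact add_comm _ _
  · rfl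

/-- The coboundary of a function on the boundary components, in the dual cell structure of
the capped surface. -/
def boundaryCoboundary : (F.BoundaryComponent → ZMod 2) →ₗ[ZMod 2] (F.Edge → ZMod 2) where
  toFun f := Quot.lift (fun h => f (F.boundary (h, true)) + f (F.boundary (h, false))) (by
    rintro h _ rfl
    exact (F.sum_boundary_flip f h).symm)
  map_add' f g := by
    ext ⟨h⟩
    change f _ + g _ + (f _ + g _) = f _ + f _ + (g _ + g _)
    abel
  map_smul' a f := by
    ext ⟨h⟩
    exact (mul_add a _ _).symm

theorem boundaryCoboundary_edge (f : F.BoundaryComponent → ZMod 2) (h : H) :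
    F.boundaryCoboundary f (F.edge h) =
      f (F.boundary (h, true)) + f (F.boundary (h, false)) := rfl

/-- The left side of `h` and the right side of `rot h` bound the same corner and lie on one boundary
component. Reindexing by `rot` makes the two halves of the sum equal, so they cancel mod 2. -/
theorem boundaryCoboundary_closed [Fintype H] (f : F.BoundaryComponent → ZMod 2)
    (g : F.Vertex → ZMod 2) :
    ∑ h, F.boundaryCoboundary f (F.edge h) * g (F.vertex h) = 0 := by
  simp only [boundaryCoboundary_edge, add_mul, Finset.sum_add_distrib]
  rw [← Equiv.sum_comp F.rot fun h => f (F.boundary (h, false)) * g (F.vertex h)]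
  simp only [boundary_rot, RotationSystem.vertex_rot, CharTwo.add_self_eq_zero]

/-- A function in the kernel agrees on the two sides of each band, hence is unchanged by `rot` and
`flip`; connectedness makes it constant. -/
theorem boundary_le_range [Finite H] (hF : F.IsConnected) :
    Nat.card F.BoundaryComponent ≤
      Module.finrank (ZMod 2) (LinearMap.range F.boundaryCoboundary) + 1 := by
  refine card_le_finrank_range_add_one _ fun f hf => ?_
  have h1 : ∀ h, f (F.boundary (h, true)) = f (F.boundary (h, false)) := fun h =>
    CharTwo.add_eq_zero.1 (congrFun hf (F.edge h))
  have h2 : ∀ h b, f (F.boundary (h, b)) = f (F.boundary (h, true)) := by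
    rintro h (_ | _)
    · exact (h1 h).symm
    · rfl
  have h3 := F.eq_of_invariant hF (fun h => f (F.boundary (h, true)))
    (fun h => by rw [← F.boundary_rot h, h2 (F.rot h) false])
    (fun h => (h2 (F.flip h) _).symm.trans (congrArg f (F.boundary_flip h true)))
  rintro ⟨⟨x, b⟩⟩ ⟨⟨y, c⟩⟩
  exact (h2 x b).trans ((h3 x y).trans (h2 y c).symm)

theorem vertices_le_range [Finite H] (hF : F.IsConnected) :
    F.numVertices ≤ Module.finrank (ZMod 2) (LinearMap.range F.vertexCoboundary) + 1 := by
  refine card_le_finrank_range_add_one _ fun g hg => ?_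
  have h := F.eq_of_invariant hF (fun h => g (F.vertex h)) (fun h => by rw [F.vertex_rot])
    (fun h => (CharTwo.add_eq_zero.1 (congrFun hg (F.edge h))).symm)
  rintro ⟨x⟩ ⟨y⟩
  exact h x y

/-- The cocycles of the dual cell structure: the sum around every vertex vanishes. -/
def cocycles [Fintype H] : Submodule (ZMod 2) (F.Edge → ZMod 2) where
  carrier := {x | ∀ g : F.Vertex → ZMod 2, ∑ h, x (F.edge h) * g (F.vertex h) = 0}
  zero_mem' g := by simp
  add_mem' hx hy g := by
    simp only [Pi.add_apply, add_mul, Finset.sum_add_distrib]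
    rw [hx g, hy g, add_zero]
  smul_mem' a x hx g := by
    simp only [Pi.smul_apply, smul_eq_mul, mul_assoc, ← Finset.mul_sum]
    rw [hx g, mul_zero]

theorem range_le_cocycles [Fintype H] : LinearMap.range F.boundaryCoboundary ≤ F.cocycles := by
  rintro _ ⟨f, rfl⟩ g
  exact F.boundaryCoboundary_closed f g

/-- Under the dot product on edge functions, the cocycles are the annihilator of the range of the
vertex coboundary. -/
theorem finrank_cocycles [Fintype H] :
    Module.finrank (ZMod 2) (LinearMap.range F.vertexCoboundary) +
      Module.finrank (ZMod 2) F.cocycles = F.numEdges := by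
  classical
  have := Fintype.ofFinite F.Edge
  have h1 : F.cocycles = (LinearMap.range F.vertexCoboundary).dualAnnihilator.comap
      (dotProductEquiv (ZMod 2) F.Edge).toLinearMap := by
    ext x
    simp only [Submodule.mem_comap, Submodule.mem_dualAnnihilator, LinearMap.mem_range,
      forall_exists_index, forall_apply_eq_imp_iff]
    refine forall_congr' fun g => ?_
    rw [← F.sum_mul_vertexCoboundary]
    rfl
  have h2 := Subspace.finrank_add_finrank_dualAnnihilator_eq
    (LinearMap.range F.vertexCoboundary)
  rw [Module.finrank_fintype_fun_eq_card, ← Nat.card_eq_fintype_card] at h2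
  rw [h1, ((dotProductEquiv (ZMod 2) F.Edge).ofSubmodule' _).finrank_eq]
  exact h2

/-- With V discs, E bands and B boundary components, the two coboundaries have ranks at least V - 1
and B - 1. The second range lies in the annihilator of the first, so (V - 1) + (B - 1) ≤ E. -/
theorem euler_le_two [Finite H] (hF : F.IsConnected) : F.eulerChar ≤ 2 := by
  have := Fintype.ofFinite H
  have h1 := F.boundary_le_range hF
  have h2 := F.vertices_le_range hF
  have h3 := Submodule.finrank_mono F.range_le_cocycles
  have h4 := F.finrank_cocycles
  unfold eulerChar
  omega

/-- On a sphere every cocycle is a coboundary. -/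
theorem exists_boundaryCoboundary [Fintype H] (hF : F.IsConnected) (h : F.eulerChar = 2)
    (x : F.Edge → ZMod 2) (hx : x ∈ F.cocycles) : ∃ f, F.boundaryCoboundary f = x := by
  have h1 := F.boundary_le_range hF
  have h2 := F.vertices_le_range hF
  have h4 := F.finrank_cocycles
  unfold eulerChar at h
  -- When χ = 2 the rank estimates leave no room between coboundaries and cocycles.
  have h5 := Submodule.eq_of_le_of_finrank_le F.range_le_cocycles (by omega)
  rw [← h5] at hx
  exact hx

end BandSurface

/-! ### Planar rotation systems as untwisted surfaces -/

namespace RotationSystem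

variable {H : Type*} (R : RotationSystem H)

instance [Finite H] : Finite R.Face := inferInstanceAs (Finite (Quot _))

/-- The surface in which no band is twisted. -/
def untwisted : BandSurface H where
  toRotationSystem := R
  twisted _ := false
  twisted_flip _ := rfl

/-- The boundary components of the untwisted surface are the faces. -/
def untwistedBoundaryEquiv : R.untwisted.BoundaryComponent ≃ R.Face where
  -- The right side of `h` is the left side of the opposite half-edge.
  toFun := Quot.lift (fun p => Quot.mk _ (if p.2 then p.1 else R.flip p.1)) (by
    rintro ⟨h, b⟩ q (⟨hb, rfl⟩ | rfl)
    · obtain rfl : b = true := hb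
      apply Eq.symm
      apply Quot.sound
      change h = R.rot.symm (R.flip (R.flip (R.rot h)))
      rw [R.flip_flip, Equiv.symm_apply_apply]
    · cases b
      · rfl
      · exact congrArg (Quot.mk _) (R.flip_flip h).symm)
  invFun := Quot.lift (fun h => Quot.mk _ (h, true)) (by
    rintro h _ rfl
    have h1 := R.untwisted.boundary_flip h true
    have h2 := R.untwisted.boundary_rot (R.facePerm h)
    have h3 : R.rot (R.facePerm h) = R.flip h := R.rot.apply_symm_apply _
    change R.untwisted.boundary (R.rot (R.facePerm h), false) = _ at h2
    rw [h3] at h2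
    exact h1.symm.trans h2)
  left_inv := by
    rintro ⟨⟨h, _ | _⟩⟩
    · exact R.untwisted.boundary_flip h false
    · rfl
  right_inv := by
    rintro ⟨h⟩
    rfl

theorem untwisted_eulerChar (hR : R.IsPlanar) (hc : R.numComponents = 1) :
    R.untwisted.eulerChar = 2 := by
  have h := hR
  unfold IsPlanar at h
  rw [hc] at h
  unfold BandSurface.eulerChar
  rw [Nat.card_congr R.untwistedBoundaryEquiv]
  exact h

end RotationSystem

/-! ### Curves of the split skeleton and their invariance under isomorphism -/

namespace SignedSkeleton

variable {H : Type*} (G : SignedSkeleton H)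

/-- The curve of the `A`-splitting through a half-edge. -/
def curveA (h : H) : G.CurveA := Quot.mk _ h

/-- The curve of the `B`-splitting through a half-edge. -/
def curveB (h : H) : G.CurveB := Quot.mk _ h

/-- The ends of the half-edges, joined across the edges on either side. -/
def FlipStep (p q : H × Bool) : Prop := q = (G.flip p.1, p.2)

/-- The curves which turn at every corner and run along both sides of every edge are the curves
of the two splittings. -/
def curvesEquiv : Quot (ReturnStep G.rot G.FlipStep) ≃ G.CurveA ⊕ G.CurveB where
  toFun := Quot.lift
    -- Whether the sign matches the side is constant along a curve: a corner changes both, an edge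
    -- neither. If they match, each corner goes anticlockwise from + to -, as in G_A; otherwise from
    -- - to +, as in G_B.
    (fun p => if G.sign p.1 = p.2 then Sum.inl (G.curveA p.1) else Sum.inr (G.curveB p.1)) (by
      rintro ⟨h, b⟩ q (⟨hb, rfl⟩ | rfl)
      · obtain rfl : b = true := hb
        by_cases hs : G.sign h = true
        · have hs' : G.sign (G.rot h) = false := by rw [G.sign_rot, hs]; rfl
          rw [if_pos hs, if_pos hs']
          exact congrArg _ (Quot.sound (Or.inr ⟨hs, rfl⟩))
        · have hs' : G.sign (G.rot h) = true := by rw [G.sign_rot]; simpa using hs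
          rw [if_neg hs, if_neg (by simp [hs'])]
          refine congrArg _ (Eq.symm (Quot.sound (Or.inr ⟨hs', ?_⟩)))
          exact (G.rot.symm_apply_apply h).symm
      · simp only [G.sign_flip]
        split_ifs <;> exact congrArg _ (Quot.sound (Or.inl rfl)))
  invFun := Sum.elim
    (Quot.lift (fun h => Quot.mk _ (h, G.sign h)) (by
      rintro h _ (rfl | ⟨hs, rfl⟩)
      · rw [G.sign_flip]
        exact Quot.sound (Or.inr rfl)
      · rw [G.sign_rot, hs]
        exact Quot.sound (Or.inl ⟨rfl, rfl⟩)))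
    (Quot.lift (fun h => Quot.mk _ (h, !G.sign h)) (by
      rintro h _ (rfl | ⟨hs, rfl⟩)
      · rw [G.sign_flip]
        exact Quot.sound (Or.inr rfl)
      · have h1 := G.sign_rot (G.rot.symm h)
        rw [Equiv.apply_symm_apply] at h1
        rw [← h1, hs]
        refine Eq.symm (Quot.sound (Or.inl ⟨rfl, ?_⟩))
        exact Prod.ext (G.rot.apply_symm_apply h).symm rfl))
  left_inv := by
    rintro ⟨⟨h, b⟩⟩
    change Sum.elim _ _ (if G.sign h = b then Sum.inl (G.curveA h) else Sum.inr (G.curveB h)) = _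
    by_cases hs : G.sign h = b
    · rw [if_pos hs]
      exact congrArg (fun c => Quot.mk _ (h, c)) hs
    · have hs' : (!G.sign h) = b := by
        revert hs
        cases G.sign h <;> cases b <;> simp
      rw [if_neg hs]
      exact congrArg (fun c => Quot.mk _ (h, c)) hs'
  right_inv := by
    rintro (⟨⟨h⟩⟩ | ⟨⟨h⟩⟩)
    · exact if_pos rfl
    · exact if_neg (by simp)

theorem numVertices_eq_of_isomorphic {H' : Type*} {G' : SignedSkeleton H'} (h : G.Isomorphic G') :
    G.numVertices = G'.numVertices := by
  obtain ⟨e, hrot, -, -⟩ := h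
  refine Nat.card_congr (Quot.congr e fun x y => ?_)
  rw [← hrot, e.apply_eq_iff_eq]

theorem numCurvesA_eq_of_isomorphic {H' : Type*} {G' : SignedSkeleton H'} (h : G.Isomorphic G') :
    G.numCurvesA = G'.numCurvesA := by
  obtain ⟨e, hrot, hflip, hsign⟩ := h
  refine Nat.card_congr (Quot.congr e fun x y => ?_)
  rw [← hrot, ← hflip, hsign, e.apply_eq_iff_eq, e.apply_eq_iff_eq]

theorem numCurvesB_eq_of_isomorphic {H' : Type*} {G' : SignedSkeleton H'} (h : G.Isomorphic G') :
    G.numCurvesB = G'.numCurvesB := by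
  obtain ⟨e, hrot, hflip, hsign⟩ := h
  refine Nat.card_congr (Quot.congr e fun x y => ?_)
  have hrot' : G'.rot.symm (e x) = e (G.rot.symm x) := by
    rw [Equiv.symm_apply_eq, ← hrot, Equiv.apply_symm_apply]
  rw [hrot', ← hflip, hsign, e.apply_eq_iff_eq, e.apply_eq_iff_eq]

end SignedSkeleton

namespace LinkDiagram

variable {C : Type*} (D : LinkDiagram C)

theorem isOver_add_one (c : C) (i : ZMod 4) : isOver (c, i + 1) = !isOver (c, i) := by
  have key : ∀ i : ZMod 4,
      decide (i + 1 = 1 ∨ i + 1 = 3) = !decide (i = 1 ∨ i = 3) := by decide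
  exact key i

/-! #### The boundary of the extreme states surface and the extreme states -/

/-- The state circle through a half-edge. -/
def circle (s : C → Marker) (h : C × ZMod 4) : D.StateCircle s := Quot.mk _ h

/-- The boundary components of the extreme states surface are the state circles of the two extreme
states. -/
def boundaryEquivCircles :
    D.extremeStatesSurface.BoundaryComponent ≃
      D.StateCircle (stateA : C → Marker) ⊕ D.StateCircle (stateB : C → Marker) where
  toFun := Quot.lift
    -- The test is constant along the boundary: a disc arc changes both over/under and side, while a
    -- band changes the side exactly when it changes over/under.
    (fun p => if isOver p.1 = p.2 then Sum.inr (D.circle stateB p.1)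
      else Sum.inl (D.circle stateA p.1)) (by
      rintro ⟨⟨c, i⟩, b⟩ q (⟨hb, rfl⟩ | rfl)
      · obtain rfl : b = true := hb
        change (if isOver (c, i) = true then Sum.inr (D.circle stateB (c, i))
          else Sum.inl (D.circle stateA (c, i))) = if isOver (c, i + 1) = false then
          Sum.inr (D.circle stateB (c, i + 1)) else Sum.inl (D.circle stateA (c, i + 1))
        rw [isOver_add_one]
        by_cases hi : isOver (c, i) = true
        · rw [if_pos hi, if_pos (by rw [hi]; rfl)]
          refine congrArg _ (Quot.sound (Or.inr ?_))
          have hi' : i = 1 ∨ i = 3 := by simpa [isOver] using hi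
          simp only [splitPartner, stateB, if_pos hi']
        · rw [if_neg hi, if_neg (by simpa using hi)]
          refine congrArg _ (Quot.sound (Or.inr ?_))
          have hi' : ¬ (i = 1 ∨ i = 3) := by simpa [isOver] using hi
          simp only [splitPartner, stateA, if_neg hi']
      · change (if isOver (c, i) = b then Sum.inr (D.circle stateB (c, i))
          else Sum.inl (D.circle stateA (c, i))) =
          if isOver (D.glue (c, i)) =
            (if (isOver (D.glue (c, i)) == isOver (c, i)) = true then b else !b) then
          Sum.inr (D.circle stateB (D.glue (c, i))) else Sum.inl (D.circle stateA (D.glue (c, i)))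
        have e : (isOver (D.glue (c, i)) =
            (if (isOver (D.glue (c, i)) == isOver (c, i)) = true then b else !b)) ↔
            isOver (c, i) = b := by
          cases isOver (D.glue (c, i)) <;> cases isOver (c, i) <;> cases b <;> decide
        have hc : ∀ s, D.circle s (D.glue (c, i)) = D.circle s (c, i) := fun s =>
          Eq.symm (Quot.sound (Or.inl rfl))
        simp only [e, hc])
  invFun := Sum.elim
    (Quot.lift (fun h => D.extremeStatesSurface.boundary (h, !isOver h)) (by
      rintro ⟨c, i⟩ q (rfl | rfl)
      · rw [← D.extremeStatesSurface.boundary_flip]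
        refine congrArg _ (Prod.ext rfl ?_)
        change (if (isOver (D.glue (c, i)) == isOver (c, i)) = true then _ else _) = _
        cases isOver (D.glue (c, i)) <;> cases isOver (c, i) <;> rfl
      · by_cases hi : i = 1 ∨ i = 3
        · have ho : isOver (c, i) = true := by simpa [isOver] using hi
          simp only [splitPartner, stateA, if_pos hi]
          have h1 := D.extremeStatesSurface.boundary_rot (c, i - 1)
          have h2 : D.extremeStatesSurface.rot (c, i - 1) = (c, i) :=
            Prod.ext rfl (sub_add_cancel i 1)
          have h3 := isOver_add_one c (i - 1)
          rw [h2] at h1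
          rw [sub_add_cancel] at h3
          rw [← h3, ho]
          exact h1
        · have ho : isOver (c, i) = false := by simpa [isOver] using hi
          simp only [splitPartner, stateA, if_neg hi]
          rw [isOver_add_one, ho]
          exact (D.extremeStatesSurface.boundary_rot (c, i)).symm))
    (Quot.lift (fun h => D.extremeStatesSurface.boundary (h, isOver h)) (by
      rintro ⟨c, i⟩ q (rfl | rfl)
      · rw [← D.extremeStatesSurface.boundary_flip]
        refine congrArg _ (Prod.ext rfl ?_)
        change (if (isOver (D.glue (c, i)) == isOver (c, i)) = true then _ else _) = _
        cases isOver (D.glue (c, i)) <;> cases isOver (c, i) <;> rfl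
      · by_cases hi : i = 1 ∨ i = 3
        · have ho : isOver (c, i) = true := by simpa [isOver] using hi
          simp only [splitPartner, stateB, if_pos hi]
          rw [isOver_add_one, ho]
          exact (D.extremeStatesSurface.boundary_rot (c, i)).symm
        · have ho : isOver (c, i) = false := by simpa [isOver] using hi
          simp only [splitPartner, stateB, if_neg hi]
          have h1 := D.extremeStatesSurface.boundary_rot (c, i - 1)
          have h2 : D.extremeStatesSurface.rot (c, i - 1) = (c, i) :=
            Prod.ext rfl (sub_add_cancel i 1)
          have h3 := isOver_add_one c (i - 1)
          rw [h2] at h1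
          rw [sub_add_cancel, ho] at h3
          rw [show isOver (c, i - 1) = true by simpa using h3.symm, ho]
          exact h1))
  left_inv := by
    rintro ⟨⟨h, b⟩⟩
    change Sum.elim _ _ (if isOver h = b then Sum.inr (D.circle stateB h)
      else Sum.inl (D.circle stateA h)) = _
    by_cases hs : isOver h = b
    · rw [if_pos hs]
      exact congrArg (fun c => Quot.mk _ (h, c)) hs
    · have hs' : (!isOver h) = b := by
        revert hs
        cases isOver h <;> cases b <;> simp
      rw [if_neg hs]
      exact congrArg (fun c => Quot.mk _ (h, c)) hs'
  right_inv := by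
    rintro (⟨⟨h⟩⟩ | ⟨⟨h⟩⟩)
    · exact if_neg (by simp)
    · exact if_pos rfl

/-! #### The boundary of the extreme states surface and the skeleton -/

/-- The boundary components of the extreme states surface follow the regions of the projection and
change sides at the non-alternating edges. -/
def boundaryEquivEnds [Finite C] :
    D.extremeStatesSurface.BoundaryComponent ≃
      Quot (EndStep D.projection.facePerm D.NonAlternating D.skeleton.FlipStep) where
  toFun := Quot.lift
    -- Near its crossing, the left side of `h` is where the facial walk begins to run along `h`; the
    -- right side is where the walk along `glue h` ends.
    (fun p => Quot.mk _ (if p.2 then (p.1, false) else (D.glue p.1, true))) (by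
      rintro ⟨h, b⟩ q (⟨hb, rfl⟩ | rfl)
      · obtain rfl : b = true := hb
        refine Eq.symm (Quot.sound (Or.inl ⟨rfl, ?_⟩))
        refine Prod.ext ?_ rfl
        change h = D.projection.rot.symm (D.glue (D.glue (D.projection.rot h)))
        rw [D.glue_glue, Equiv.symm_apply_apply]
      · change Quot.mk _ (if b = true then (h, false) else (D.glue h, true)) = Quot.mk _
          (if (if (isOver (D.glue h) == isOver h) = true then b else !b) = true then
            (D.glue h, false) else (D.glue (D.glue h), true))
        rw [D.glue_glue]
        -- A half-twisted band joins beginning to beginning and end to end across the edge, which is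
        -- `FlipStep`; an untwisted one joins the beginning and end of one facial side.
        by_cases hn : D.NonAlternating h
        · have hg := (D.nonAlternating_glue h).1 hn
          rw [if_pos (show (isOver (D.glue h) == isOver h) = true from beq_iff_eq.2 hn)]
          cases b
          · exact Eq.symm (Quot.sound (Or.inr (Or.inr ⟨hn, hg, rfl⟩)))
          · exact Quot.sound (Or.inr (Or.inr ⟨hn, hg, rfl⟩))
        · have hg := fun h' => hn ((D.nonAlternating_glue h).2 h')
          rw [if_neg (show ¬ (isOver (D.glue h) == isOver h) = true from fun h' =>
            hn (beq_iff_eq.1 h'))]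
          cases b
          · exact Quot.sound (Or.inr (Or.inl ⟨hg, rfl⟩))
          · exact Quot.sound (Or.inr (Or.inl ⟨hn, rfl⟩)))
  invFun := Quot.lift
    (fun p => D.extremeStatesSurface.boundary (if p.2 then (D.glue p.1, false) else (p.1, true)))
    (by
      have flip_pos : ∀ h b, D.NonAlternating h → D.extremeStatesSurface.boundary (D.glue h, b) =
          D.extremeStatesSurface.boundary (h, b) := by
        intro h b hn
        rw [← D.extremeStatesSurface.boundary_flip h b]
        refine congrArg _ (Prod.ext rfl (Eq.symm (if_pos ?_)))
        exact beq_iff_eq.2 hn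
      have flip_neg : ∀ h b, ¬ D.NonAlternating h →
          D.extremeStatesSurface.boundary (D.glue h, !b) =
          D.extremeStatesSurface.boundary (h, b) := by
        intro h b hn
        rw [← D.extremeStatesSurface.boundary_flip h b]
        refine congrArg _ (Prod.ext rfl (Eq.symm (if_neg ?_)))
        exact fun h' => hn (beq_iff_eq.1 h')
      rintro ⟨h, b⟩ ⟨h', b'⟩ (⟨hb, e⟩ | ⟨hn, e⟩ | ⟨hn, hn', e⟩)
      · obtain rfl : b = true := hb
        obtain ⟨rfl, rfl⟩ := Prod.mk.inj e
        have h1 := D.extremeStatesSurface.boundary_rot (D.projection.facePerm h)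
        have h2 : D.extremeStatesSurface.rot (D.projection.facePerm h) = D.glue h :=
          D.projection.rot.apply_symm_apply _
        rw [h2] at h1
        exact h1
      · obtain ⟨rfl, rfl⟩ := Prod.mk.inj e
        cases b
        · exact (flip_neg _ true hn).symm
        · exact flip_neg _ true hn
      · obtain ⟨e, rfl⟩ := Prod.mk.inj e
        obtain rfl : h' = D.glue h := congrArg Subtype.val e
        cases b'
        · exact (flip_pos h true hn).symm
        · exact (flip_pos (D.glue h) false hn').symm)
  left_inv := by
    rintro ⟨⟨h, _ | _⟩⟩
    · exact congrArg D.extremeStatesSurface.boundary (Prod.ext (D.glue_glue h) rfl)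
    · rfl
  right_inv := by
    rintro ⟨⟨h, _ | _⟩⟩
    · rfl
    · exact congrArg (Quot.mk _) (Prod.ext (D.glue_glue h) rfl)

instance [Finite C] (s : C → Marker) : Finite (D.StateCircle s) := inferInstanceAs (Finite (Quot _))

/-! #### Counting -/

theorem numCircles_add_numCircles [Finite C] :
    Nat.card D.extremeStatesSurface.BoundaryComponent =
      D.numCircles stateA + D.numCircles stateB := by
  rw [Nat.card_congr D.boundaryEquivCircles, Nat.card_sum]
  rfl

/-- Regions without non-alternating edges are counted once among the faces and once among the
boundary components, so they cancel. The other regions are the skeleton's vertices, and the other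
components its curves. -/
theorem card_boundary_add_numVertices [Finite C] :
    Nat.card D.extremeStatesSurface.BoundaryComponent + D.skeleton.numVertices =
      D.projection.numFaces + D.skeleton.numCurvesA + D.skeleton.numCurvesB := by
  have h1 : Nat.card D.extremeStatesSurface.BoundaryComponent =
      Nat.card (MissedCycle D.projection.facePerm D.NonAlternating) +
        (D.skeleton.numCurvesA + D.skeleton.numCurvesB) := by
    have e := D.boundaryEquivEnds.trans ((endsEquiv _ _ _).trans
      ((Equiv.refl _).sumCongr D.skeleton.curvesEquiv))
    have : Finite D.skeleton.CurveA := inferInstanceAs (Finite (Quot _))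
    have : Finite D.skeleton.CurveB := inferInstanceAs (Finite (Quot _))
    rw [Nat.card_congr e, Nat.card_sum, Nat.card_sum]
    rfl
  have h2 : D.projection.numFaces =
      Nat.card (MissedCycle D.projection.facePerm D.NonAlternating) + D.skeleton.numVertices := by
    refine (Nat.card_congr (cyclesEquiv D.projection.facePerm D.NonAlternating)).trans ?_
    rw [Nat.card_sum]
    rfl
  omega

theorem eq_zero_add_ones (i : ZMod 4) :
    i = 0 ∨ i = 0 + 1 ∨ i = 0 + 1 + 1 ∨ i = 0 + 1 + 1 + 1 := by
  revert i
  decide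

/-- The vertices of the projection are the crossings. -/
def vertexEquivCrossing : D.projection.Vertex ≃ C where
  toFun := Quot.lift Prod.fst (by
    rintro h _ rfl
    rfl)
  invFun c := D.projection.vertex (c, 0)
  left_inv := by
    have step : ∀ (c : C) (i : ZMod 4),
        D.projection.vertex (c, i + 1) = D.projection.vertex (c, i) :=
      fun c i => D.projection.vertex_rot (c, i)
    rintro ⟨c, i⟩
    change D.projection.vertex (c, 0) = D.projection.vertex (c, i)
    rcases eq_zero_add_ones i with rfl | rfl | rfl | rfl <;> simp only [step]
  right_inv c := rfl

theorem numVertices_projection : D.projection.numVertices = D.numCrossings :=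
  Nat.card_congr D.vertexEquivCrossing

theorem card_halfEdges_eq : Nat.card (C × ZMod 4) = 4 * D.numCrossings := by
  rw [Nat.card_prod, Nat.card_zmod, mul_comm]
  rfl

theorem numEdges_projection : D.projection.numEdges = 2 * D.numCrossings := by
  have h1 := D.projection.card_halfEdges
  rw [D.card_halfEdges_eq] at h1
  omega

theorem numFaces_projection (hD : D.IsConnected) :
    D.projection.numFaces = D.numCrossings + 2 := by
  have h : (D.projection.numVertices : ℤ) - D.projection.numEdges + D.projection.numFaces =
      2 * D.projection.numComponents := D.planar
  rw [D.numVertices_projection, D.numEdges_projection, show D.projection.numComponents = 1 from hD]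
    at h
  push_cast at h
  omega

theorem eulerChar_extremeStatesSurface [Finite C] :
    D.extremeStatesSurface.eulerChar =
      (D.numCircles stateA : ℤ) + D.numCircles stateB - D.numCrossings := by
  have h1 : D.extremeStatesSurface.numVertices = D.numCrossings := D.numVertices_projection
  have h2 : D.extremeStatesSurface.numEdges = 2 * D.numCrossings := D.numEdges_projection
  unfold BandSurface.eulerChar
  rw [h1, h2, D.numCircles_add_numCircles]
  push_cast
  ring

theorem eulerChar_eq_skeleton [Finite C] (hD : D.IsConnected) :
    D.extremeStatesSurface.eulerChar =
      2 - (D.skeleton.numVertices : ℤ) + D.skeleton.numCurvesA + D.skeleton.numCurvesB := by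
  have h1 := D.eulerChar_extremeStatesSurface
  have h2 := D.card_boundary_add_numVertices
  rw [D.numCircles_add_numCircles, D.numFaces_projection hD] at h2
  omega

theorem extremeStatesBound_eq [Finite C] :
    D.extremeStatesBound = 4 * (D.numCrossings : ℤ) + 2 * D.extremeStatesSurface.eulerChar - 4 := by
  have hA : numLabel (stateA : C → Marker) .A = D.numCrossings :=
    Nat.card_congr (Equiv.subtypeUnivEquiv fun _ => rfl)
  have hB : numLabel (stateB : C → Marker) .B = D.numCrossings :=
    Nat.card_congr (Equiv.subtypeUnivEquiv fun _ => rfl)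
  have hA' : numLabel (stateA : C → Marker) .B = 0 := by
    have : IsEmpty {c : C // stateA c = Marker.B} := ⟨fun c => nomatch c.2⟩
    exact Nat.card_of_isEmpty
  have hB' : numLabel (stateB : C → Marker) .A = 0 := by
    have : IsEmpty {c : C // stateB c = Marker.A} := ⟨fun c => nomatch c.2⟩
    exact Nat.card_of_isEmpty
  rw [D.eulerChar_extremeStatesSurface]
  unfold extremeStatesBound maxDeg minDeg
  rw [hA, hB, hA', hB']
  push_cast
  ring

/-! #### The chessboard colouring -/

/-- The regions of a connected diagram can be coloured like a chessboard; a half-edge gets the colour of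
the region to its left. -/
theorem exists_chessboard [Finite C] (hD : D.IsConnected) :
    ∃ κ : C × ZMod 4 → Bool, (∀ c i, κ (c, i + 1) = !κ (c, i)) ∧ ∀ h, κ (D.glue h) = !κ h := by
  have := Fintype.ofFinite C
  -- The constant 1 is a cocycle because every crossing has even valency. A primitive of it takes
  -- different values on the two sides of each edge, so it is the colouring.
  obtain ⟨f, hf⟩ := D.projection.untwisted.exists_boundaryCoboundary hD
    (D.projection.untwisted_eulerChar D.planar hD) (fun _ => 1) (by
      intro g
      simp only [one_mul]
      rw [Fintype.sum_prod_type]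
      refine Finset.sum_eq_zero fun c _ => ?_
      have hg : ∀ i, g (D.projection.untwisted.vertex (c, i)) =
          g (D.projection.untwisted.vertex (c, 0)) := fun i =>
        congrArg g (D.vertexEquivCrossing.injective rfl)
      simp only [hg, Finset.sum_const, Finset.card_univ, ZMod.card]
      rw [nsmul_eq_mul, show ((4 : ℕ) : ZMod 2) = 0 from rfl, zero_mul])
  have key : ∀ a b : ZMod 2, a + b = 1 → decide (b = 1) = !decide (a = 1) := by decide
  have hf' : ∀ h, f (D.projection.untwisted.boundary (h, true)) +
      f (D.projection.untwisted.boundary (h, false)) = 1 := fun h =>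
    congrFun hf (D.projection.untwisted.edge h)
  refine ⟨fun h => decide (f (D.projection.untwisted.boundary (h, true)) = 1), ?_, ?_⟩
  · intro c i
    refine key _ _ ?_
    rw [← D.projection.untwisted.boundary_rot (c, i), add_comm]
    exact hf' (c, i + 1)
  · intro h
    refine key _ _ ?_
    have h1 : D.projection.untwisted.boundary (D.glue h, true) =
        D.projection.untwisted.boundary (h, false) :=
      D.projection.untwisted.boundary_flip h false
    rw [h1]
    exact hf' h

/-- Colour and over/under both alternate around a crossing, so their `xor` depends on the crossing
only and decides which discs to reverse. Along an edge the colour always changes, so this value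
changes exactly when the edge is non-alternating. -/
theorem isOrientable_extremeStatesSurface [Finite C] (hD : D.IsConnected) :
    D.extremeStatesSurface.IsOrientable := by
  obtain ⟨κ, hrot, hglue⟩ := D.exists_chessboard hD
  refine ⟨Quot.lift (fun h => xor (κ h) (isOver h)) ?_, ?_⟩
  · rintro ⟨c, i⟩ _ rfl
    change _ = xor (κ (c, i + 1)) (isOver (c, i + 1))
    rw [hrot, isOver_add_one]
    cases κ (c, i) <;> cases isOver (c, i) <;> rfl
  · intro h
    change (isOver (D.glue h) == isOver h) =
      xor (xor (κ h) (isOver h)) (xor (κ (D.glue h)) (isOver (D.glue h)))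
    rw [hglue]
    cases κ h <;> cases isOver h <;> cases isOver (D.glue h) <;> rfl

/-! #### Parity -/

theorem splitPartner_splitPartner (m : Marker) (i : ZMod 4) :
    splitPartner m (splitPartner m i) = i := by
  cases m <;> revert i <;> decide

theorem splitPartner_eq (m : Marker) (i : ZMod 4) :
    splitPartner m i = i + 1 ∨ splitPartner m i + 1 = i := by
  cases m <;> revert i <;> decide

/-- The two splittings differ by a half-turn at the crossing; the parity argument rests on this. -/
theorem splitPartner_A_eq (i : ZMod 4) : splitPartner .A i = splitPartner .B i + 1 + 1 := by
  revert i
  decide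

/-- The joining of half-edges when every crossing has the same splitting. -/
def splitPerm (m : Marker) : Equiv.Perm (C × ZMod 4) :=
  Function.Involutive.toPerm (fun h => (h.1, splitPartner m h.2))
    fun h => Prod.ext rfl (splitPartner_splitPartner m h.2)

/-- The half-turn at every crossing. -/
def halfTurn : Equiv.Perm (C × ZMod 4) :=
  Function.Involutive.toPerm (fun h => (h.1, h.2 + 1 + 1)) fun h => Prod.ext rfl (by
    have key : ∀ i : ZMod 4, i + 1 + 1 + 1 + 1 = i := by decide
    exact key h.2)

variable {κ : C × ZMod 4 → Bool}

theorem chessboard_splitPerm (hrot : ∀ c i, κ (c, i + 1) = !κ (c, i)) (m : Marker)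
    (h : C × ZMod 4) : κ (splitPerm m h) = !κ h := by
  obtain ⟨c, i⟩ := h
  change κ (c, splitPartner m i) = _
  rcases splitPartner_eq m i with e | e
  · rw [e, hrot]
  · conv_rhs => rw [← e, hrot, Bool.not_not]

theorem chessboard_halfTurn (hrot : ∀ c i, κ (c, i + 1) = !κ (c, i)) (h : C × ZMod 4) :
    κ (halfTurn h) = κ h := by
  change κ (h.1, h.2 + 1 + 1) = _
  rw [hrot, hrot, Bool.not_not]

/-- The half-turns have two points of each colour at every crossing. -/
def halfTurnCyclesEquiv (hrot : ∀ c i, κ (c, i + 1) = !κ (c, i)) :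
    (halfTurn.subtypePerm fun h => by rw [chessboard_halfTurn hrot] :
      Equiv.Perm {h // κ h = true}).Cycles ≃ C where
  toFun := Quot.lift (fun h => h.1.1) (by
    rintro h _ rfl
    rfl)
  invFun c := Quot.mk _ (if h : κ (c, 0) = true then ⟨(c, 0), h⟩
    else ⟨(c, 0 + 1), by rw [hrot]; simpa using h⟩)
  left_inv := by
    rintro ⟨⟨⟨c, i⟩, hi⟩⟩
    change Quot.mk _ (if h : κ (c, 0) = true then _ else _) = _
    rcases eq_zero_add_ones i with rfl | rfl | rfl | rfl
    · rw [dif_pos hi]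
    · rw [dif_neg (by rw [hrot] at hi; simpa using hi)]
    · rw [dif_pos (by simpa only [hrot, Bool.not_not] using hi)]
      exact Quot.sound rfl
    · rw [dif_neg (by simpa only [hrot, Bool.not_not, Bool.not_eq_true, Bool.not_eq_true'] using hi)]
      exact Quot.sound rfl
  right_inv c := by
    by_cases h : κ (c, 0) = true
    · simp [h]
    · simp [h]

/-- On the half-edges of one colour, crossing an edge and then following the splitting is a
permutation whose cycles are the state circles. The permutations for `A` and `B` differ by the
half-turn, which has one cycle per crossing. As the number of points is even, each sign is the
parity of the number of cycles, and multiplicativity gives the claim. -/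
theorem even_numCircles_add [Finite C] (hD : D.IsConnected) :
    Even (D.numCircles stateA + D.numCircles stateB + D.numCrossings) := by
  classical
  have := Fintype.ofFinite C
  obtain ⟨κ, hrot, hglue⟩ := D.exists_chessboard hD
  let π (m : Marker) : Equiv.Perm {h // κ h = true} :=
    (splitPerm m * D.glue).subtypePerm fun h => by
      rw [Equiv.Perm.mul_apply, chessboard_splitPerm hrot, hglue, Bool.not_not]
  let ρ : Equiv.Perm {h // κ h = true} :=
    halfTurn.subtypePerm fun h => by rw [chessboard_halfTurn hrot]
  have hcircles : ∀ m : Marker, D.numCircles (fun _ => m) = Nat.card (π m).Cycles := fun m =>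
    Nat.card_congr (quotTwoEquivCycles D.glue (splitPerm m) D.glue_glue
      (fun h => Prod.ext rfl (splitPartner_splitPartner m h.2)) κ hglue
      (chessboard_splitPerm hrot m) (π m) fun _ => rfl)
  have hρ : Nat.card ρ.Cycles = D.numCrossings := Nat.card_congr (halfTurnCyclesEquiv hrot)
  have hmul : π .A = ρ * π .B := by
    ext1 h
    exact Subtype.ext (Prod.ext rfl (splitPartner_A_eq _))
  -- Gluing exchanges the colours, so each colour has half of the 4c half-edges.
  have hcard : Even (Nat.card {h // κ h = true}) := by
    have e : {h // κ h = true} ≃ {h // ¬ κ h = true} :=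
      D.glue.subtypeEquiv fun h => by rw [hglue]; cases κ h <;> simp
    have h1 := Nat.card_congr (Equiv.sumCompl fun h => κ h = true)
    rw [Nat.card_sum, ← Nat.card_congr e, D.card_halfEdges_eq] at h1
    exact ⟨D.numCrossings, by omega⟩
  have hsign := congrArg Equiv.Perm.sign hmul
  rw [Equiv.Perm.sign_mul, Equiv.Perm.sign_eq_pow_card_cycles, Equiv.Perm.sign_eq_pow_card_cycles,
    Equiv.Perm.sign_eq_pow_card_cycles, ← hcircles, ← hcircles, hρ, pow_add, pow_add, pow_add,
    hcard.neg_one_pow, one_mul, one_mul, one_mul] at hsign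
  have h2 : (-1 : ℤˣ) ^ (D.numCircles stateA + D.numCircles stateB + D.numCrossings) = 1 := by
    rw [pow_add, pow_add]
    change (-1 : ℤˣ) ^ D.numCircles (fun _ => .A) * (-1 : ℤˣ) ^ D.numCircles (fun _ => .B) * _ = 1
    rw [hsign, mul_comm, ← mul_assoc, ← mul_assoc, ← pow_add, mul_assoc, ← pow_add,
      Even.neg_one_pow ⟨_, rfl⟩, Even.neg_one_pow ⟨_, rfl⟩, one_mul]
  by_contra ho
  rw [Nat.not_even_iff_odd] at ho
  rw [ho.neg_one_pow] at h2
  exact absurd h2 (by decide)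

theorem exists_hasGenus [Finite C] (hD : D.IsConnected) :
    ∃ g : ℕ, D.extremeStatesSurface.HasGenus g := by
  have h1 := D.extremeStatesSurface.euler_le_two hD
  obtain ⟨k, hk⟩ := D.even_numCircles_add hD
  have h2 := D.eulerChar_extremeStatesSurface
  -- Here χ = 2k - 2c, so 2 - 2g = χ forces this value; it is nonnegative because χ ≤ 2.
  obtain ⟨g, hg⟩ : ∃ g : ℕ, (g : ℤ) = 1 + D.numCrossings - k :=
    ⟨(1 + D.numCrossings - k : ℤ).toNat, Int.toNat_of_nonneg (by omega)⟩
  exact ⟨g, hD, D.isOrientable_extremeStatesSurface hD, by omega⟩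

end LinkDiagram

end

/-! ### The main theorem -/

theorem mainTheorem4 {C : Type*} [Finite C] (D : LinkDiagram C) (hD : D.IsConnected) :
    D.extremeStatesSurface.eulerChar =
      2 - (D.skeleton.numVertices : ℤ) + D.skeleton.numCurvesA + D.skeleton.numCurvesB ∧
    (∃ g : ℕ, D.extremeStatesSurface.HasGenus g ∧
      D.extremeStatesBound = 4 * (D.numCrossings : ℤ) - 4 * g ∧
      4 * (D.numCrossings : ℤ) - 4 * g =
        4 * (D.numCrossings : ℤ) +
          2 * ((D.skeleton.numCurvesA : ℤ) + D.skeleton.numCurvesB) -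
          2 * (D.skeleton.numVertices : ℤ)) ∧
    (∀ (C' : Type*) [Finite C'] (D' : LinkDiagram C'), D'.IsConnected →
      D.skeleton.Isomorphic D'.skeleton →
      D.extremeStatesBound - 4 * (D.numCrossings : ℤ) =
        D'.extremeStatesBound - 4 * (D'.numCrossings : ℤ)) := by
  have h1 := D.eulerChar_eq_skeleton hD
  have h2 := D.extremeStatesBound_eq
  refine ⟨h1, ?_, ?_⟩
  · obtain ⟨g, hg⟩ := D.exists_hasGenus hD
    have h3 := hg.2.2
    exact ⟨g, hg, by omega, by omega⟩
  · intro C' _ D' hD' hiso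
    have h3 := D'.eulerChar_eq_skeleton hD'
    have h4 := D'.extremeStatesBound_eq
    rw [← SignedSkeleton.numVertices_eq_of_isomorphic _ hiso,
      ← SignedSkeleton.numCurvesA_eq_of_isomorphic _ hiso,
      ← SignedSkeleton.numCurvesB_eq_of_isomorphic _ hiso] at h3
    omega
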